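/- Let $X$ be a real Hausdorff locally convex topological vector space, let $K\subseteq X$ be nonempty, convex and closed, let $D\subseteq K$ be self segment-dense in $K$, that is, $D$ is dense in $K$ and for all $x,y\in D$ the set $[x,y]\cap D$ is dense in the closed segment $[x,y]$, and let $F:K\times K\rightrightarrows\mathbb{R}$ be a set-valued map such that (i) for every $y\in D$, the map $x\mapsto F(x,y)$ is lower semicontinuous at every point of $K$; (ii) for every $x\in K$, the map $y\mapsto F(x,y)$, defined on $K$, is lower semicontinuous at every point of $K\setminus D$; (iii) for every $x\in D$, the map $y\mapsto F(x,y)$ is convex on $D$; (iv) for every $x\in D$, $F(x,x)\subseteq[0,\infty)$; (v) there are a compact set $K_0\subseteq X$ and a point $y_0\in D\cap K_0$ such that $F(x,y_0)\cap(-\infty,0)\neq\emptyset$ for all $x\in K\setminus K_0$. Then there exists $x_0\in K$ such that $F(x_0,y)\subseteq[0,\infty)$ for all $y\in K$. Here a set-valued map $T:K\rightrightarrows\mathbb{R}$ is lower semicontinuous at $z\in K$ if $T(z)\neq\emptyset$ and for every open $N\subseteq\mathbb{R}$ with $T(z)\cap N\neq\emptyset$ there is a neighbourhood $M$ of $z$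 in $K$ such that $T(w)\cap N\neq\emptyset$ for all $w\in M$ with $T(w)\neq\emptyset$ (so (i) and (ii) include that $F$ has nonempty values). It is convex on $D$ if $\sum_{i=1}^n\lambda_iT(u_i)\subseteq T\left(\sum_{i=1}^n\lambda_iu_i\right)$ (Minkowski sum) for all $n\ge1$, $u_1,\dots,u_n\in D$ and $\lambda_1,\dots,\lambda_n\ge0$ with $\sum_{i=1}^n\lambda_i=1$ and $\sum_{i=1}^n\lambda_iu_i\in D$. -/

import Mathlib

open scoped Pointwise

/-- The domain `{z | T z ≠ ∅}` of a set-valued map `T`. -/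
def SetValued.dom {Z Y : Type*} (T : Z → Set Y) : Set Z := {z | (T z).Nonempty}

/-- Lower semicontinuity at `z`, a point of the domain, of the set-valued map `T` considered as a map
on `S` with its subspace topology: for every open `N` that meets `T z` there is a neighbourhood
`M` of `z` such that `T w` meets `N` for all `w ∈ M ∩ S` in the domain of `T`. -/
def SetValued.LscWithinAt {Z Y : Type*} [TopologicalSpace Z] [TopologicalSpace Y]
    (T : Z → Set Y) (S : Set Z) (z : Z) : Prop :=
  z ∈ SetValued.dom T ∧ LowerHemicontinuousWithinAt T (S ∩ SetValued.dom T) z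

/-- Convexity on `D` (which need not be convex) of a set-valued map `T`: for all `u i ∈ D` and all
weights `c i ≥ 0` with sum `1` such that `∑ c i • u i ∈ D`, the Minkowski combination
`∑ c i • T (u i)` is contained in `T (∑ c i • u i)`. -/
def SetValued.ConvexOn {X Y : Type*} [AddCommGroup X] [Module ℝ X] [AddCommGroup Y] [Module ℝ Y]
    (T : X → Set Y) (D : Set X) : Prop :=
  ∀ (n : ℕ) (u : Fin n → X) (c : Fin n → ℝ), (∀ i, u i ∈ D) → (∀ i, 0 ≤ c i) → ∑ i, c i = 1 →
    ∑ i, c i • u i ∈ D → ∑ i, c i • T (u i) ⊆ T (∑ i, c i • u i)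

/-- `U ⊆ V` is self segment-dense in the (convex) set `V`: `U` is dense in `V`, and for all `x, y ∈ U`
the set `[x, y] ∩ U` is dense in the closed segment `[x, y]`. -/
structure SelfSegmentDense {X : Type*} [AddCommGroup X] [Module ℝ X] [TopologicalSpace X]
    (U V : Set X) : Prop where
  subset : U ⊆ V
  dense : V ⊆ closure U
  segment_dense : ∀ x ∈ U, ∀ y ∈ U, segment ℝ x y ⊆ closure (segment ℝ x y ∩ U)

/-! For `y ∈ D` put G(y) = {x ∈ K | F(x,y) ⊆ [0,∞)}. Lower semicontinuity in x makes G(y) closed,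
and coercivity makes G(y₀) compact, so a point common to all G(y), y ∈ D, exists once finite
subfamilies intersect. Lower semicontinuity in y and density of D then carry the conclusion from D
to K.

Finite intersections come from the KKM principle, which needs conv{y₁,…,yₙ} ⊆ ⋃ G(yᵢ). As D need not
be convex, convexity of F(x,·) and F(x,x) ⊆ [0,∞) give this only at points of D in the hull
(`SetValued.ConvexOn.exists_subset_Ici`). By self segment-density these points are dense in the hull
(`SelfSegmentDense.convexHull_subset_closure`), and a finite union of closed sets is closed.

KKM itself is derived from Scarf's lemma, a parity argument on dominant sets. Applied to the
coordinate orders on grid points of a simplex, it yields small clusters of grid points playing the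
role of Sperner's fully coloured cells; compactness does the rest. -/

/-- A finite set `S` is dominant for a family `r` of rankings if no point of the ambient type lies
strictly above `S` in all the rankings, in the sense that every `y` is below all of `S` in one of
them. -/
def ScarfDominant {I V : Type*} (r : I → V → ℕ) (S : Finset V) : Prop :=
  ∀ y, ∃ i, ∀ x ∈ S, r i y ≤ r i x

/-- `v` is the `i`-highest point among those above `m k` in the `k`-th ranking for all `k ≠ i`. -/
def ScarfPivot {I V : Type*} (r : I → V → ℕ) (m : I → V) (i : I) (v : V) : Prop :=
  (∀ k, k ≠ i → r k (m k) < r k v) ∧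
    ∀ y, (∀ k, k ≠ i → r k (m k) < r k y) → r i y ≤ r i v

/-! ### Pivoting between dominant sets -/

section Scarf

variable {I V : Type*} {r : I → V → ℕ}

theorem ScarfDominant.mono {S W : Finset V} (hS : ScarfDominant r S) (h : W ⊆ S) :
    ScarfDominant r W := fun y => (hS y).imp fun _ hi x hx => hi x (h hx)

theorem ScarfPivot.unique (hr : ∀ i, Function.Injective (r i)) {m : I → V} {i : I} {v w : V}
    (hv : ScarfPivot r m i v) (hw : ScarfPivot r m i w) : v = w :=
  hr i (le_antisymm (hw.2 v hv.1) (hv.2 w hw.1))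

theorem exists_scarfPivot [Fintype V] {m : I → V} {i : I} {y : V}
    (hy : ∀ k, k ≠ i → r k (m k) < r k y) : ∃ v, ScarfPivot r m i v := by
  classical
  obtain ⟨v, hv, hmax⟩ := Finset.exists_max_image
    (Finset.univ.filter fun y => ∀ k, k ≠ i → r k (m k) < r k y) (r i) ⟨y, by simpa using hy⟩
  exact ⟨v, (Finset.mem_filter.1 hv).2, fun z hz => hmax z (by simpa using hz)⟩

/-- In a dominant set with one element less than there are rankings, exactly two rankings share
their lowest point. -/
theorem ScarfDominant.exists_argmin [Fintype I] (hr : ∀ i, Function.Injective (r i))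
    {W : Finset V} (hW : ScarfDominant r W) (hne : W.Nonempty)
    (hcard : W.card + 1 = Fintype.card I) :
    ∃ m : I → V, (∀ i, m i ∈ W) ∧ (∀ i, ∀ x ∈ W, r i (m i) ≤ r i x) ∧
      ∃ a b, a ≠ b ∧ m a = m b ∧ (∀ w ∈ W, ∃ i, i ≠ a ∧ m i = w) ∧
        (∀ w ∈ W, ∃ i, i ≠ b ∧ m i = w) ∧
        ∀ i j, i ≠ j → m i = m j → (i = a ∧ j = b) ∨ (i = b ∧ j = a) := by
  classical
  choose m hmW hm using fun i => Finset.exists_min_image W (r i) hne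
  have hsurj : ∀ w ∈ W, ∃ i, m i = w := fun w hw => by
    obtain ⟨i, hi⟩ := hW w
    exact ⟨i, hr i (le_antisymm (hm i w hw) (hi _ (hmW i)))⟩
  obtain ⟨a, -, b, -, hab, hmab⟩ := Finset.exists_ne_map_eq_of_card_lt_of_maps_to
    (s := Finset.univ) (t := W) (f := m) (by rw [Finset.card_univ]; omega) (fun i _ => hmW i)
  have hsa : ∀ w ∈ W, ∃ i, i ≠ a ∧ m i = w := fun w hw => by
    obtain ⟨i, rfl⟩ := hsurj w hw
    by_cases h : i = a
    · exact ⟨b, hab.symm, by rw [h, hmab]⟩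
    · exact ⟨i, h, rfl⟩
  have hsb : ∀ w ∈ W, ∃ i, i ≠ b ∧ m i = w := fun w hw => by
    obtain ⟨i, rfl⟩ := hsurj w hw
    by_cases h : i = b
    · exact ⟨a, hab, by rw [h, hmab]⟩
    · exact ⟨i, h, rfl⟩
  -- Without `a` the map `m` is still onto `W`, now from a set of the same size, hence injective.
  -- The same holds for `b`, so any collision involves both.
  have hinj : ∀ a, (∀ w ∈ W, ∃ i, i ≠ a ∧ m i = w) →
      ∀ i j, i ≠ a → j ≠ a → m i = m j → i = j := fun a ha i j hi hj hij => by
    have himg : (Finset.univ.erase a).image m = W := by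
      ext w
      simp only [Finset.mem_image, Finset.mem_erase, Finset.mem_univ, and_true]
      exact ⟨fun ⟨i, _, h⟩ => h ▸ hmW i, ha w⟩
    have hc : ((Finset.univ.erase a).image m).card = (Finset.univ.erase a).card := by
      rw [himg, Finset.card_erase_of_mem (Finset.mem_univ a), Finset.card_univ]; omega
    exact Finset.card_image_iff.1 hc (by simpa using hi) (by simpa using hj) hij
  refine ⟨m, hmW, hm, a, b, hab, hmab, hsa, hsb, fun i j hij hmij => ?_⟩
  have h1 := hinj a hsa
  have h2 := hinj b hsb
  grind

/-- The points that extend a dominant set with one element less than there are rankings to a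
dominant set are the pivots at the two rankings that share their lowest point. -/
theorem scarfDominant_insert_iff [DecidableEq V] (hr : ∀ i, Function.Injective (r i))
    {W : Finset V} (hW : ScarfDominant r W) {m : I → V} (hmW : ∀ i, m i ∈ W)
    (hm : ∀ i, ∀ x ∈ W, r i (m i) ≤ r i x) {a b : I} (hmab : m a = m b)
    (hsa : ∀ w ∈ W, ∃ i, i ≠ a ∧ m i = w) (hsb : ∀ w ∈ W, ∃ i, i ≠ b ∧ m i = w)
    (hinj : ∀ i j, i ≠ j → m i = m j → (i = a ∧ j = b) ∨ (i = b ∧ j = a)) (v : V) :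
    (v ∉ W ∧ ScarfDominant r (insert v W)) ↔ ScarfPivot r m a v ∨ ScarfPivot r m b v := by
  constructor
  · rintro ⟨hv, hdom⟩
    obtain ⟨i, hi⟩ := hdom v
    -- `v` is lowest in ranking `i`, so dominance at `w` makes `w` lowest in some other ranking.
    -- Hence `m i` is also the minimum of another ranking, which forces `i` to be `a` or `b`.
    have hlt : ∀ w ∈ W, ∃ j, j ≠ i ∧ m j = w ∧ r j (m j) < r j v := fun w hw => by
      obtain ⟨j, hj⟩ := hdom w
      have hmj : m j = w := hr j (le_antisymm (hm j w hw) (hj _ (by simp [hmW j])))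
      have hne : m j ≠ v := fun h => hv (h ▸ hmW j)
      have hjv : r j (m j) < r j v :=
        lt_of_le_of_ne (hmj ▸ hj v (by simp)) fun h => hne (hr j h)
      refine ⟨j, ?_, hmj, hjv⟩
      rintro rfl
      exact absurd (hi (m j) (by simp [hmW j])) (not_le.2 hjv)
    have hiab : i = a ∨ i = b := by
      obtain ⟨j, hj, hmj, -⟩ := hlt (m i) (hmW i)
      rcases hinj j i hj hmj with h | h
      exacts [Or.inr h.2, Or.inl h.2]
    have hp : ScarfPivot r m i v := by
      constructor
      · intro k hk
        obtain ⟨j, hj, hmj, hjv⟩ := hlt (m k) (hmW k)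
        by_cases hjk : j = k
        · exact hjk ▸ hjv
        · rcases hinj j k hjk hmj with h | h <;> rcases hiab with h' | h' <;> grind
      · intro y hy
        obtain ⟨l, hl⟩ := hdom y
        by_cases hli : l = i
        · exact hli ▸ hl v (by simp)
        · exact absurd (hl (m l) (by simp [hmW l])) (not_le.2 (hy l hli))
    rcases hiab with rfl | rfl
    exacts [Or.inl hp, Or.inr hp]
  · have key : ∀ i, (∀ w ∈ W, ∃ j, j ≠ i ∧ m j = w) → ScarfPivot r m i v →
        v ∉ W ∧ ScarfDominant r (insert v W) := by
      intro i hs hp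
      refine ⟨fun hv => ?_, fun y => ?_⟩
      · obtain ⟨j, hj, rfl⟩ := hs v hv
        exact lt_irrefl _ (hp.1 j hj)
      · by_cases hy : ∀ k, k ≠ i → r k (m k) < r k y
        · obtain ⟨l, hl⟩ := hW y
          have hli : l = i := by
            by_contra h
            exact absurd (hl (m l) (hmW l)) (not_le.2 (hy l h))
          subst hli
          refine ⟨l, fun x hx => ?_⟩
          rcases Finset.mem_insert.1 hx with rfl | hx
          exacts [hp.2 y hy, hl x hx]
        · push Not at hy
          obtain ⟨k, hk, hyk⟩ := hy
          refine ⟨k, fun x hx => ?_⟩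
          rcases Finset.mem_insert.1 hx with rfl | hx
          exacts [hyk.trans (hp.1 k hk).le, hyk.trans (hm k x hx)]
    rintro (h | h)
    exacts [key a hsa h, key b hsb h]

open Classical in
/-- The number of ways to extend a dominant set with one element less than there are rankings
to a larger dominant set: two if the set meets the complement of the slack points, one otherwise. -/
theorem card_scarfDominant_insert [Fintype I] [Fintype V] (hr : ∀ i, Function.Injective (r i))
    {e : I → V} (hei : Function.Injective e) (he : ∀ i v, v ≠ e i → r i (e i) < r i v)
    (he' : ∀ i j v, v ∉ Set.range e → j ≠ i → r i v < r i (e j))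
    {W : Finset V} (hW : ScarfDominant r W) (hne : W.Nonempty)
    (hcard : W.card + 1 = Fintype.card I) :
    ((∃ t ∈ W, t ∉ Set.range e) →
      (Finset.univ.filter fun v => v ∉ W ∧ ScarfDominant r (insert v W)).card = 2) ∧
    (∀ j, W = (Finset.univ.erase j).image e →
      (Finset.univ.filter fun v => v ∉ W ∧ ScarfDominant r (insert v W)).card = 1) := by
  obtain ⟨m, hmW, hm, a, b, hab, hmab, hsa, hsb, hinj⟩ := hW.exists_argmin hr hne hcard
  have hfilter : (Finset.univ.filter fun v => v ∉ W ∧ ScarfDominant r (insert v W)) =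
      Finset.univ.filter fun v => ScarfPivot r m a v ∨ ScarfPivot r m b v :=
    Finset.filter_congr fun v _ => scarfDominant_insert_iff hr hW hmW hm hmab hsa hsb hinj v
  rw [hfilter]
  constructor
  · rintro ⟨t, ht, hte⟩
    have hex : ∀ i, ∃ v, ScarfPivot r m i v := fun i =>
      exists_scarfPivot (y := e i) fun k hk => (hm k t ht).trans_lt (he' k i t hte hk.symm)
    obtain ⟨v, hv⟩ := hex a
    obtain ⟨w, hw⟩ := hex b
    -- A common pivot would lie above the minimum of `W` in every ranking, against dominance.
    have hvw : v ≠ w := by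
      rintro rfl
      obtain ⟨k, hk⟩ := hW v
      by_cases hka : k = a
      · exact absurd (hk _ (hmW k)) (not_le.2 (hw.1 k (hka ▸ hab)))
      · exact absurd (hk _ (hmW k)) (not_le.2 (hv.1 k hka))
    rw [← Finset.card_pair hvw]
    congr 1
    ext u
    simp only [Finset.mem_filter, Finset.mem_univ, true_and, Finset.mem_insert,
      Finset.mem_singleton]
    constructor
    · rintro (h | h)
      exacts [Or.inl (h.unique hr hv), Or.inr (h.unique hr hw)]
    · rintro (rfl | rfl)
      exacts [Or.inl hv, Or.inr hw]
  · intro j hj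
    have hme : ∀ k, k ≠ j → m k = e k := fun k hk => by
      by_contra h
      exact absurd (hm k (e k) (by rw [hj]; simpa using ⟨k, hk, rfl⟩)) (not_le.2 (he k _ h))
    have hmj : ∃ k, k ≠ j ∧ m j = e k := by
      have := hmW j
      rw [hj] at this
      obtain ⟨k, hk, hk'⟩ := Finset.mem_image.1 this
      exact ⟨k, (Finset.mem_erase.1 hk).1, hk'.symm⟩
    obtain ⟨k, hkj, hmk⟩ := hmj
    have hpj : ∃ v, ScarfPivot r m j v := exists_scarfPivot (y := e j) fun l hl => by
      rw [hme l hl]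
      exact he l _ fun h => hl (hei h).symm
    -- A pivot at `k` would exceed `e k` in ranking `j`. No non-slack point does, and each slack
    -- point fails in ranking `j` or in its own.
    have hpk : ∀ v, ¬ ScarfPivot r m k v := fun v hv => by
      have hvj := hv.1 j hkj.symm
      rw [hmk] at hvj
      have hve : v ∉ Set.range e := by
        rintro ⟨l, rfl⟩
        by_cases hlk : l = k
        · exact lt_irrefl _ (hlk ▸ hvj)
        · by_cases hlj : l = j
          · subst hlj
            exact lt_asymm hvj (he l _ fun h => hlk (hei h).symm)
          · exact lt_irrefl _ (hme l hlj ▸ hv.1 l hlk)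
      exact lt_asymm hvj (he' j k v hve hkj)
    obtain ⟨v, hv⟩ := hpj
    rw [← Finset.card_singleton v]
    congr 1
    ext u
    simp only [Finset.mem_filter, Finset.mem_univ, true_and, Finset.mem_singleton]
    rcases hinj j k hkj.symm (by rw [hmk, hme k hkj]) with ⟨rfl, rfl⟩ | ⟨rfl, rfl⟩
    · exact ⟨fun h => h.elim (fun h => h.unique hr hv) fun h => (hpk _ h).elim,
        fun h => Or.inl (h ▸ hv)⟩
    · exact ⟨fun h => h.elim (fun h => (hpk _ h).elim) fun h => h.unique hr hv,
        fun h => Or.inr (h ▸ hv)⟩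

end Scarf

/-! ### Scarf's lemma by a parity count -/

open Classical in
/-- A set with as many points as there are colours, not using all colours, has zero or two
subsets, obtained by removing a point, whose colours are all except `a`. -/
theorem even_card_erase_of_image_ne {I V : Type*} [Fintype I] [Fintype V] {c : V → I} {a : I}
    {S : Finset V} (hcard : S.card = Fintype.card I) (hS : S.image c ≠ Finset.univ) :
    Even (Finset.univ.filter fun W : Finset V =>
      (W.card + 1 = Fintype.card I ∧ W.image c = Finset.univ.erase a) ∧ W ⊆ S).card := by
  set Ω := Finset.univ.filter fun W : Finset V =>
      (W.card + 1 = Fintype.card I ∧ W.image c = Finset.univ.erase a) ∧ W ⊆ S with hΩ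
  have hmem : ∀ W, W ∈ Ω ↔
      (W.card + 1 = Fintype.card I ∧ W.image c = Finset.univ.erase a) ∧ W ⊆ S := by
    simp [hΩ]
  rcases Ω.eq_empty_or_nonempty with h | ⟨W, hW⟩
  · simp [h]
  obtain ⟨⟨hWc, hWi⟩, hWS⟩ := (hmem W).1 hW
  obtain ⟨x, hxW, rfl⟩ : ∃ x, x ∉ W ∧ insert x W = S :=
    Finset.exists_eq_insert_iff.2 ⟨hWS, by omega⟩
  have hxa : c x ≠ a := fun h => hS (by
    rw [Finset.image_insert, hWi, h, Finset.insert_erase (Finset.mem_univ a)])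
  have hinj : Set.InjOn c W := Finset.card_image_iff.1 (by
    rw [hWi, Finset.card_erase_of_mem (Finset.mem_univ a), Finset.card_univ]; omega)
  obtain ⟨y, hyW, hyx⟩ : ∃ y ∈ W, c y = c x := by
    have : c x ∈ W.image c := by rw [hWi]; simpa using hxa
    simpa using this
  have hyx' : y ≠ x := fun h => hxW (h ▸ hyW)
  -- The colour of `x` occurs once more in `insert x W`, at `y`, so only `x` or `y` can be removed
  -- without losing a colour.
  have hpair : Ω = {W, (insert x W).erase y} := by
    ext U
    rw [hmem, Finset.mem_insert, Finset.mem_singleton]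
    constructor
    · rintro ⟨⟨hUc, hUi⟩, hUS⟩
      obtain ⟨z, hzU, hz⟩ : ∃ z, z ∉ U ∧ insert z U = insert x W :=
        Finset.exists_eq_insert_iff.2 ⟨hUS, by omega⟩
      have hU : U = (insert x W).erase z := by rw [← hz, Finset.erase_insert hzU]
      have hzS : z ∈ insert x W := hz ▸ Finset.mem_insert_self z U
      rcases Finset.mem_insert.1 hzS with rfl | hzW
      · exact Or.inl (by rw [hU, Finset.erase_insert hxW])
      · refine Or.inr ?_
        have hza : c z ∈ U.image c := by
          rw [hUi, ← hWi]
          exact Finset.mem_image_of_mem c hzW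
        obtain ⟨u, huU, huz⟩ := Finset.mem_image.1 hza
        have huz' : u ≠ z := fun h => hzU (h ▸ huU)
        rcases Finset.mem_insert.1 (hUS huU) with rfl | huW
        · rw [hU, hinj hzW hyW (huz.symm.trans hyx.symm)]
        · exact absurd (hinj huW hzW huz) huz'
    · rintro (rfl | rfl)
      · exact ⟨⟨hWc, hWi⟩, hWS⟩
      · refine ⟨⟨?_, ?_⟩, Finset.erase_subset _ _⟩
        · rw [Finset.card_erase_of_mem (Finset.mem_insert_of_mem hyW),
            Finset.card_insert_of_notMem hxW]
          simpa using hWc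
        · rw [← hWi]
          ext i
          simp only [Finset.mem_image, Finset.mem_erase, Finset.mem_insert]
          constructor
          · rintro ⟨u, ⟨huy, rfl | huW⟩, rfl⟩
            exacts [⟨y, hyW, hyx⟩, ⟨u, huW, rfl⟩]
          · rintro ⟨u, huW, rfl⟩
            by_cases huy : u = y
            · exact ⟨x, ⟨hyx'.symm, Or.inl rfl⟩, by rw [huy, hyx]⟩
            · exact ⟨u, ⟨huy, Or.inr huW⟩, rfl⟩
  rw [hpair, Finset.card_pair]
  · exact even_two
  · intro h
    exact absurd hyW (h ▸ Finset.notMem_erase y _)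

open Classical in
/-- **Scarf's lemma** for rankings with slack points. -/
theorem exists_scarfDominant_image_eq_univ {I V : Type*} [Fintype I] [Nontrivial I] [Fintype V]
    {r : I → V → ℕ} (hr : ∀ i, Function.Injective (r i)) {e : I → V}
    (hei : Function.Injective e) (he : ∀ i v, v ≠ e i → r i (e i) < r i v)
    (he' : ∀ i j v, v ∉ Set.range e → j ≠ i → r i v < r i (e j)) {c : V → I}
    (hc : ∀ i, c (e i) = i) :
    ∃ S : Finset V, S.card = Fintype.card I ∧ ScarfDominant r S ∧ S.image c = Finset.univ := by
  obtain ⟨a, a', haa'⟩ := exists_pair_ne I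
  have hI : 1 < Fintype.card I := Fintype.one_lt_card
  let rooms : Finset (Finset V) := Finset.univ.filter fun S =>
    S.card = Fintype.card I ∧ ScarfDominant r S
  let doors : Finset (Finset V) := Finset.univ.filter fun W =>
    W.card + 1 = Fintype.card I ∧ W.image c = Finset.univ.erase a
  let W₀ : Finset V := (Finset.univ.erase a).image e
  have hW₀c : W₀.card + 1 = Fintype.card I := by
    rw [Finset.card_image_of_injective _ hei, Finset.card_erase_of_mem (Finset.mem_univ a),
      Finset.card_univ]
    omega
  have hW₀i : W₀.image c = Finset.univ.erase a := by
    rw [Finset.image_image, show c ∘ e = id from funext hc, Finset.image_id]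
  have hW₀d : ScarfDominant r W₀ := by
    have hlow : ∀ k x, r k (e k) ≤ r k x := fun k x => by
      by_cases h : x = e k
      · rw [h]
      · exact (he k x h).le
    intro y
    by_cases hy : y ∈ Set.range e
    · obtain ⟨k, rfl⟩ := hy
      exact ⟨k, fun x _ => hlow k x⟩
    · refine ⟨a, fun x hx => ?_⟩
      obtain ⟨k, hk, rfl⟩ := Finset.mem_image.1 hx
      exact (he' a k y hy (Finset.mem_erase.1 hk).1).le
  -- Every door except the all-slack one lies in zero or two rooms, so the number of incidences is
  -- odd. Without a fully coloured room, counting by rooms would make it even.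
  have hcount : ∀ W ∈ doors, Odd (rooms.filter fun S => W ⊆ S).card ↔ W = W₀ := by
    intro W hW
    obtain ⟨hWc, hWi⟩ := (Finset.mem_filter.1 hW).2
    have hWne : W.Nonempty := Finset.card_pos.1 (by omega)
    have hbij : (rooms.filter fun S => W ⊆ S).card =
        (Finset.univ.filter fun v => v ∉ W ∧ ScarfDominant r (insert v W)).card := by
      symm
      refine Finset.card_bij (fun v _ => insert v W) ?_ ?_ ?_
      · intro v hv
        obtain ⟨hvW, hvd⟩ := (Finset.mem_filter.1 hv).2
        simp only [rooms, Finset.mem_filter, Finset.mem_univ, true_and]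
        exact ⟨⟨by rw [Finset.card_insert_of_notMem hvW, hWc], hvd⟩, Finset.subset_insert v W⟩
      · intro v hv w hw hvw
        exact (Finset.insert_inj (Finset.mem_filter.1 hv).2.1).1 hvw
      · intro S hS
        simp only [rooms, Finset.mem_filter, Finset.mem_univ, true_and] at hS
        obtain ⟨x, hxW, rfl⟩ : ∃ x, x ∉ W ∧ insert x W = S :=
          Finset.exists_eq_insert_iff.2 ⟨hS.2, by omega⟩
        exact ⟨x, by simpa using ⟨hxW, hS.1.2⟩, rfl⟩
    rw [hbij]
    by_cases hd : ScarfDominant r W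
    · obtain ⟨h2, h1⟩ := card_scarfDominant_insert hr hei he he' hd hWne hWc
      by_cases ht : ∃ t ∈ W, t ∉ Set.range e
      · rw [h2 ht]
        refine iff_of_false (by decide) ?_
        rintro rfl
        obtain ⟨t, ht, hte⟩ := ht
        obtain ⟨k, -, rfl⟩ := Finset.mem_image.1 ht
        exact hte ⟨k, rfl⟩
      · push Not at ht
        have hWW₀ : W = W₀ := by
          refine Finset.eq_of_subset_of_card_le (fun t htW => ?_) (by omega)
          obtain ⟨k, rfl⟩ := ht t htW
          have : c (e k) ∈ W.image c := Finset.mem_image_of_mem c htW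
          rw [hWi, hc] at this
          exact Finset.mem_image_of_mem e this
        rw [h1 a hWW₀]
        exact iff_of_true odd_one hWW₀
    · rw [Finset.filter_false_of_mem fun v _ h => hd (h.2.mono (Finset.subset_insert v W))]
      refine iff_of_false (by simp) ?_
      rintro rfl
      exact hd hW₀d
  have hodd : Odd (∑ W ∈ doors, (rooms.filter fun S => W ⊆ S).card) := by
    rw [Finset.odd_sum_iff_odd_card_odd, Finset.filter_congr hcount, Finset.filter_eq',
      if_pos (by simpa [doors] using ⟨hW₀c, hW₀i⟩), Finset.card_singleton]
    exact odd_one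
  have hswap : ∑ W ∈ doors, (rooms.filter fun S => W ⊆ S).card =
      ∑ S ∈ rooms, (doors.filter fun W => W ⊆ S).card :=
    Finset.sum_card_bipartiteAbove_eq_sum_card_bipartiteBelow (fun W S : Finset V => W ⊆ S)
  rw [hswap] at hodd
  by_contra hno
  refine (Nat.not_even_iff_odd.2 hodd) (Finset.even_sum _ fun S hS => ?_)
  obtain ⟨hSc, hSd⟩ := (Finset.mem_filter.1 hS).2
  have := even_card_erase_of_image_ne (c := c) (a := a) hSc fun h => hno ⟨S, hSc, hSd, h⟩
  rwa [Finset.filter_filter]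

open Classical in
/-- **Scarf's lemma**: given finitely many preorders, by values `f i`, on a finite set coloured by
the index set of the preorders, some nonempty `S` is dominated by no point in all the preorders that
are colours of points of `S`. -/
theorem exists_dominated_by_colors {I T : Type*} [Fintype I] [Nontrivial I] [Fintype T]
    [Nonempty T] (f : I → T → ℕ) (c : T → I) :
    ∃ S : Finset T, S.Nonempty ∧ ∀ y, ∃ i ∈ S.image c, ∀ x ∈ S, f i y ≤ f i x := by
  let t : T ≃ Fin (Fintype.card T) := Fintype.equivFin T
  let s : I ≃ Fin (Fintype.card I) := Fintype.equivFin I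
  let N := Fintype.card T
  obtain ⟨B, hB⟩ : ∃ B, ∀ i x, f i x * N + t x + 1 < B := by
    refine ⟨(∑ i, ∑ x, (f i x * N + t x + 1)) + 1, fun i x => Nat.lt_succ_of_le ?_⟩
    calc f i x * N + t x + 1 ≤ ∑ x, (f i x * N + t x + 1) :=
          Finset.single_le_sum (f := fun x => f i x * N + (t x : ℕ) + 1)
            (fun _ _ => Nat.zero_le _) (Finset.mem_univ x)
      _ ≤ _ := Finset.single_le_sum (f := fun i => ∑ x, (f i x * N + (t x : ℕ) + 1))
            (fun _ _ => Nat.zero_le _) (Finset.mem_univ i)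
  -- The term `t x < N` breaks ties of `f i`. The `+ 1` reserves rank 0 for the slack point of `i`,
  -- and `B` lifts the other slack points above all of `T`.
  let r : I → T ⊕ I → ℕ := fun i => Sum.elim (fun x => f i x * N + t x + 1)
    fun j => if j = i then 0 else B + s j
  have hlt : ∀ x : T, (t x : ℕ) < N := fun x => (t x).2
  have hr : ∀ i, Function.Injective (r i) := by
    rintro i (x | j) (y | k) h
    · have h' : f i x * N + t x = f i y * N + t y := by simpa [r] using h
      have h2 : (t x : ℕ) = t y := by
        have := congrArg (· % N) h'
        simpa [Nat.mod_eq_of_lt (hlt _)] using this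
      exact congrArg _ (t.injective (Fin.ext h2))
    · simp only [r, Sum.elim_inl, Sum.elim_inr] at h
      have := hB i x
      split_ifs at h <;> omega
    · simp only [r, Sum.elim_inl, Sum.elim_inr] at h
      have := hB i y
      split_ifs at h <;> omega
    · simp only [r, Sum.elim_inr] at h
      have := hB i (Classical.arbitrary T)
      split_ifs at h with h1 h2 h2
      · rw [h1, h2]
      · omega
      · omega
      · exact congrArg _ (s.injective (Fin.ext (by omega)))
  obtain ⟨S, -, hSd, hSi⟩ := exists_scarfDominant_image_eq_univ (r := r) hr (e := Sum.inr)
    Sum.inr_injective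
    (by
      rintro i (x | j) h
      · simp [r]
      · have hji : j ≠ i := fun h' => h (h' ▸ rfl)
        have := hB i (Classical.arbitrary T)
        simp only [r, Sum.elim_inr, if_true, if_neg hji]
        omega)
    (by
      rintro i j (x | k) h hji
      · simp only [r, Sum.elim_inl, Sum.elim_inr, if_neg hji]
        exact (hB i x).trans_le (Nat.le_add_right _ _)
      · exact absurd ⟨k, rfl⟩ h)
    (c := Sum.elim c id) (fun i => rfl)
  have key : ∀ y, ∃ i ∈ (S.toLeft).image c, ∀ x ∈ S.toLeft, f i y ≤ f i x := by
    intro y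
    obtain ⟨i, hi⟩ := hSd (Sum.inl y)
    -- The slack point of `i` has rank 0, below `y`; so colour `i` must be carried by a genuine
    -- point of `T`.
    have hiS : Sum.inr i ∉ S := fun h => by
      have := hi _ h
      simp [r] at this
    refine ⟨i, ?_, fun x hx => ?_⟩
    · have : i ∈ S.image (Sum.elim c id) := hSi ▸ Finset.mem_univ i
      obtain ⟨(x | j), hx, hxi⟩ := Finset.mem_image.1 this
      · exact Finset.mem_image.2 ⟨x, Finset.mem_toLeft.2 hx, hxi⟩
      · exact absurd hx (by rw [show j = i from hxi]; exact hiS)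
    · have h1 : f i y * N + t y + 1 ≤ f i x * N + t x + 1 := hi _ (Finset.mem_toLeft.1 hx)
      have h2 := hlt x
      by_contra h
      push Not at h
      have : (f i x + 1) * N ≤ f i y * N := Nat.mul_le_mul_right N h
      rw [Nat.add_mul] at this
      omega
  refine ⟨S.toLeft, ?_, key⟩
  obtain ⟨i, hi, -⟩ := key (Classical.arbitrary T)
  exact Finset.image_nonempty.1 ⟨i, hi⟩

/-! ### From grid colourings to the KKM theorem -/

open Classical in
/-- A colouring of the grid points of denominator `m` in a simplex has a small cluster of points in
which every colour occurs, except those of coordinates that are small throughout the cluster. -/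
theorem exists_cluster_piAntidiag {I : Type*} [Fintype I] [Nontrivial I] (m : ℕ)
    (c : Finset.piAntidiag (Finset.univ : Finset I) m → I) :
    ∃ S : Finset (Finset.piAntidiag (Finset.univ : Finset I) m), S.Nonempty ∧ ∃ a : I → ℕ,
      (∀ x ∈ S, ∀ i, a i ≤ x.1 i ∧ x.1 i < a i + Fintype.card I) ∧
      ∀ i, (∃ x ∈ S, c x = i) ∨ a i = 0 := by
  have hsum : ∀ x : Finset.piAntidiag (Finset.univ : Finset I) m, ∑ i, x.1 i = m := fun x =>
    (Finset.mem_piAntidiag.1 x.2).1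
  obtain ⟨a₀⟩ : Nonempty I := inferInstance
  have : Nonempty (Finset.piAntidiag (Finset.univ : Finset I) m) :=
    ⟨⟨Pi.single a₀ m, Finset.mem_piAntidiag.2 ⟨by simp, by simp⟩⟩⟩
  obtain ⟨S, hS, hdom⟩ := exists_dominated_by_colors
    (fun i (x : Finset.piAntidiag (Finset.univ : Finset I) m) => x.1 i) c
  choose z hzS hz using fun i => Finset.exists_min_image S (fun x => x.1 i) hS
  let a : I → ℕ := fun i => if i ∈ S.image c then (z i).1 i else 0
  have hale : ∀ x ∈ S, ∀ i, a i ≤ x.1 i := fun x hx i => by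
    simp only [a]
    split_ifs
    exacts [hz i x hx, Nat.zero_le _]
  -- Otherwise there is room for a grid point exceeding `a` by at least 1 in every coordinate,
  -- strictly above the minimum over `S` in each occurring colour.
  have hlarge : m < ∑ i, a i + Fintype.card I := by
    by_contra hcon
    push Not at hcon
    obtain ⟨j, -, -⟩ := hdom (z a₀)
    let y : I → ℕ := fun i => a i + 1 + if i = j then m - (∑ i, a i + Fintype.card I) else 0
    have hy : y ∈ Finset.piAntidiag (Finset.univ : Finset I) m := by
      refine Finset.mem_piAntidiag.2 ⟨?_, by simp⟩
      simp only [y, Finset.sum_add_distrib, Finset.sum_ite_eq', Finset.mem_univ, if_true,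
        Finset.sum_const, Finset.card_univ, smul_eq_mul, mul_one]
      omega
    obtain ⟨i, hi, hiy⟩ := hdom ⟨y, hy⟩
    have h1 : y i ≤ (z i).1 i := hiy _ (hzS i)
    have h2 : a i = (z i).1 i := if_pos hi
    have h3 : a i + 1 ≤ y i := Nat.le_add_right _ _
    omega
  refine ⟨S, hS, a, fun x hx i => ⟨hale x hx i, ?_⟩, fun i => ?_⟩
  · have h1 : ∑ i, (x.1 i - a i) + ∑ i, a i = m := by
      rw [← Finset.sum_add_distrib]
      exact (Finset.sum_congr rfl fun i _ => Nat.sub_add_cancel (hale x hx i)).trans (hsum x)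
    have h2 : x.1 i - a i ≤ ∑ i, (x.1 i - a i) :=
      Finset.single_le_sum (f := fun i => x.1 i - a i) (fun _ _ => Nat.zero_le _)
        (Finset.mem_univ i)
    omega
  · by_cases hi : i ∈ S.image c
    · exact Or.inl (Finset.mem_image.1 hi)
    · exact Or.inr (if_neg hi)

/-- If closed sets `A i` cover the standard simplex and `A i` contains the face opposite to the
vertex `i`, then the sets `A i` have a common point in the simplex. -/
theorem exists_mem_iInter_of_opposite_face_subset {I : Type*} [Fintype I] [Nontrivial I]
    {A : I → Set (I → ℝ)} (hA : ∀ i, IsClosed (A i))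
    (hcover : ∀ x ∈ stdSimplex ℝ I, ∃ i, x ∈ A i)
    (hface : ∀ x ∈ stdSimplex ℝ I, ∀ i, x i = 0 → x ∈ A i) :
    ∃ x ∈ stdSimplex ℝ I, ∀ i, x ∈ A i := by
  classical
  by_contra! hno
  obtain ⟨δ, hδ, hball⟩ := lebesgue_number_lemma_of_metric (isCompact_stdSimplex (𝕜 := ℝ) (ι := I))
    (c := fun i => (A i)ᶜ) (fun i => (hA i).isOpen_compl) fun x hx => by
      obtain ⟨i, hi⟩ := hno x hx
      exact Set.mem_iUnion.2 ⟨i, hi⟩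
  obtain ⟨m, hm⟩ := exists_nat_gt ((Fintype.card I : ℝ) / δ)
  have hm0 : (0 : ℝ) < m := lt_of_le_of_lt (by positivity) hm
  have hnm : (Fintype.card I : ℝ) / m < δ := by
    rw [div_lt_iff₀ hδ] at hm
    rw [div_lt_iff₀ hm0]
    linarith
  let p : Finset.piAntidiag (Finset.univ : Finset I) m → I → ℝ := fun x i => x.1 i / m
  have hp : ∀ x, p x ∈ stdSimplex ℝ I := fun x => by
    refine ⟨fun i => by positivity, ?_⟩
    have h : ∑ i, x.1 i = m := (Finset.mem_piAntidiag.1 x.2).1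
    simp only [p]
    rw [← Finset.sum_div, ← Nat.cast_sum, h, div_self hm0.ne']
  choose c hc using fun x => hcover (p x) (hp x)
  obtain ⟨S, ⟨x, hx⟩, a, ha, hac⟩ := exists_cluster_piAntidiag m c
  obtain ⟨i, hi⟩ := hball (p x) (hp x)
  rcases hac i with ⟨y, hy, rfl⟩ | h0
  · refine hi (Metric.mem_ball.2 ?_) (hc y)
    refine (dist_pi_lt_iff hδ).2 fun k => lt_of_le_of_lt ?_ hnm
    have h1 := ha x hx k
    have h2 := ha y hy k
    have h3 : (y.1 k : ℝ) ≤ x.1 k + Fintype.card I := by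
      exact_mod_cast (show y.1 k ≤ x.1 k + Fintype.card I by omega)
    have h4 : (x.1 k : ℝ) ≤ y.1 k + Fintype.card I := by
      exact_mod_cast (show x.1 k ≤ y.1 k + Fintype.card I by omega)
    rw [Real.dist_eq, ← sub_div, abs_div, abs_of_pos hm0]
    gcongr
    rw [abs_le]
    constructor <;> linarith
  · obtain ⟨j, hj⟩ := exists_ne i
    have hxi : p x i ≤ Fintype.card I / m := by
      have h1 := (ha x hx i).2
      have : (x.1 i : ℝ) ≤ Fintype.card I := by
        exact_mod_cast (show x.1 i ≤ Fintype.card I by omega)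
      simp only [p]
      gcongr
    have hpos : ∀ k, 0 ≤ p x k := (hp x).1
    -- When `a i = 0` the coordinate `p x i` is small; moving it to `j` reaches the face opposite
    -- `i` within distance `δ`.
    let q : I → ℝ := fun k =>
      p x k + ((if k = j then p x i else 0) - if k = i then p x i else 0)
    have hqi : q i = 0 := by simp [q, hj.symm]
    have hq : q ∈ stdSimplex ℝ I := by
      constructor
      · intro k
        by_cases hk : k = i
        · rw [hk, hqi]
        · have := hpos k
          have := hpos i
          simp only [q, if_neg hk]
          split_ifs <;> linarith
      · simp only [q, Finset.sum_add_distrib, Finset.sum_sub_distrib, Finset.sum_ite_eq',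
          Finset.mem_univ, if_true, sub_self, add_zero]
        exact (hp x).2
    refine hi (Metric.mem_ball.2 ?_) (hface q hq i hqi)
    refine (dist_pi_lt_iff hδ).2 fun k => lt_of_le_of_lt ?_ (hxi.trans_lt hnm)
    have := hpos i
    rw [Real.dist_eq, abs_le]
    simp only [q]
    split_ifs <;> constructor <;> linarith

/-- The **Knaster-Kuratowski-Mazurkiewicz theorem** for the standard simplex: if every point of
the simplex lies in some `B i` with `i` in its support, the closed sets `B i` have a common point. -/
theorem exists_mem_iInter_of_forall_exists_pos {I : Type*} [Fintype I] [Nonempty I]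
    {B : I → Set (I → ℝ)} (hB : ∀ i, IsClosed (B i))
    (hcover : ∀ x ∈ stdSimplex ℝ I, ∃ i, 0 < x i ∧ x ∈ B i) :
    ∃ x ∈ stdSimplex ℝ I, ∀ i, x ∈ B i := by
  classical
  -- Nonemptiness of `B i` matters: `Metric.infDist` to the empty set is 0.
  have hvert : ∀ i, Pi.single i (1 : ℝ) ∈ B i := fun i => by
    obtain ⟨k, hk, hkB⟩ := hcover _ (single_mem_stdSimplex ℝ i)
    by_cases h : k = i
    · exact h ▸ hkB
    · simp [h] at hk
  rcases subsingleton_or_nontrivial I with hI | hI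
  · obtain ⟨i⟩ : Nonempty I := inferInstance
    refine ⟨Pi.single i 1, ?_, fun k => ?_⟩
    · convert single_mem_stdSimplex ℝ i
    · rw [Subsingleton.elim k i]
      convert hvert i
  let d : I → (I → ℝ) → ℝ := fun i x => Metric.infDist x (B i)
  have hd : ∀ i, Continuous (d i) := fun i => Metric.continuous_infDist_pt _
  have hd0 : ∀ i x, 0 ≤ d i x := fun i x => Metric.infDist_nonneg
  have hmem : ∀ i x, x ∈ B i ↔ d i x = 0 := fun i x =>
    (hB i).mem_iff_infDist_zero ⟨_, hvert i⟩
  -- Since the `x i` sum to 1, these sets cover the simplex. At a common point, an `i` with `0 < x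
  -- i` and `d i x = 0` forces all distances to vanish.
  obtain ⟨x, hx, hxA⟩ := exists_mem_iInter_of_opposite_face_subset
    (A := fun i => {x | x i * ∑ j, d j x ≤ d i x})
    (fun i => isClosed_le ((continuous_apply i).mul (continuous_finsetSum _ fun j _ => hd j))
      (hd i))
    (fun x hx => by
      by_contra! h
      have : ∑ i, d i x < ∑ i, x i * ∑ j, d j x :=
        Finset.sum_lt_sum_of_nonempty Finset.univ_nonempty fun i _ => not_le.1 (h i)
      rw [← Finset.sum_mul, hx.2, one_mul] at this
      exact lt_irrefl _ this)
    (fun x _ i hxi => by simpa [hxi] using hd0 i x)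
  refine ⟨x, hx, ?_⟩
  obtain ⟨i, hi, hiB⟩ := hcover x hx
  have h1 : x i * ∑ j, d j x ≤ 0 := (hxA i).trans_eq ((hmem i x).1 hiB)
  have h2 : ∑ j, d j x = 0 :=
    le_antisymm (nonpos_of_mul_nonpos_right h1 hi) (Finset.sum_nonneg fun j _ => hd0 j x)
  exact fun j => (hmem j x).2 ((Finset.sum_eq_zero_iff_of_nonneg fun j _ => hd0 j x).1 h2 j
    (Finset.mem_univ j))

/-! ### Convexity on a self segment-dense set -/

/-- A self segment-dense set is dense in the convex hull of each of its finite subsets. -/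
theorem SelfSegmentDense.convexHull_subset_closure {X : Type*} [AddCommGroup X] [Module ℝ X]
    [TopologicalSpace X] [IsTopologicalAddGroup X] [ContinuousSMul ℝ X] {D K : Set X}
    (hD : SelfSegmentDense D K) (s : Finset X) (hs : (s : Set X) ⊆ D) :
    convexHull ℝ (s : Set X) ⊆ closure (convexHull ℝ (s : Set X) ∩ D) := by
  classical
  induction s using Finset.induction_on with
  | empty => simp
  | insert a s ha ih =>
    rw [Finset.coe_insert, Set.insert_subset_iff] at hs
    rw [Finset.coe_insert]
    rcases s.eq_empty_or_nonempty with rfl | hne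
    · simpa using subset_closure (show a ∈ {a} ∩ D from ⟨rfl, hs.1⟩)
    intro p hp
    rw [convexHull_insert (by simpa using hne), mem_convexJoin] at hp
    obtain ⟨a', ha', z, hz, α, β, hα, hβ, hαβ, rfl⟩ := hp
    rw [Set.mem_singleton_iff] at ha'
    subst ha'
    -- Replace `z` by a nearby point `w` of `D` in the smaller hull; `D` is then dense in the
    -- segment from `a'` to `w`.
    have hcont : Continuous fun z : X => α • a' + β • z := by fun_prop
    have hmaps : Set.MapsTo (fun z : X => α • a' + β • z) (convexHull ℝ (s : Set X) ∩ D)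
        (closure (convexHull ℝ (insert a' (s : Set X)) ∩ D)) := by
      rintro w ⟨hw, hwD⟩
      refine closure_mono ?_ (hD.segment_dense a' hs.1 w hwD ⟨α, β, hα, hβ, hαβ, rfl⟩)
      refine Set.inter_subset_inter_left _ ?_
      exact (convex_convexHull ℝ _).segment_subset (subset_convexHull ℝ _ (by simp))
        (convexHull_mono (Set.subset_insert _ _) hw)
    simpa only [closure_closure] using map_mem_closure hcont (ih hs.2 hz) hmaps

/-- If `T` is convex on `D` with nonnegative values at a point `x ∈ D`, then at one of any finitely
many points of `D` with `x` in their convex hull all the values of `T` are nonnegative. -/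
theorem SetValued.ConvexOn.exists_subset_Ici {X : Type*} [AddCommGroup X] [Module ℝ X]
    {T : X → Set ℝ} {D : Set X} (hT : SetValued.ConvexOn T D) {s : Finset X}
    (hs : (s : Set X) ⊆ D) {x : X} (hxD : x ∈ D) (hx : x ∈ convexHull ℝ (s : Set X))
    (hTx : T x ⊆ Set.Ici 0) : ∃ v ∈ s, T v ⊆ Set.Ici 0 := by
  by_contra! hno
  have hneg : ∀ v : s, ∃ t ∈ T v, t < 0 := fun v => by
    obtain ⟨t, ht, ht'⟩ := Set.not_subset.1 (hno v v.2)
    exact ⟨t, ht, not_le.1 ht'⟩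
  choose t htT ht using hneg
  obtain ⟨w, hw0, hw1, hwx⟩ := Finset.mem_convexHull'.1 hx
  have h1 : ∑ k, w (s.equivFin.symm k) = 1 := by
    rw [s.equivFin.symm.sum_comp (fun v : s => w v), Finset.sum_coe_sort s w, hw1]
  have hx' : ∑ k, w (s.equivFin.symm k) • (s.equivFin.symm k : X) = x := by
    rw [s.equivFin.symm.sum_comp (fun v : s => w v • (v : X)),
      Finset.sum_coe_sort s (fun v => w v • v), hwx]
  have hmem := hT s.card (fun k => s.equivFin.symm k) (fun k => w (s.equivFin.symm k))
    (fun k => hs (s.equivFin.symm k).2) (fun k => hw0 _ (s.equivFin.symm k).2) h1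
    (hx'.symm ▸ hxD) (Set.finsetSum_mem_finsetSum _ _ _ fun k _ =>
      Set.smul_mem_smul_set (htT (s.equivFin.symm k)))
  rw [hx'] at hmem
  have hnonneg := Set.mem_Ici.1 (hTx hmem)
  have hle : ∀ k ∈ Finset.univ, w (s.equivFin.symm k) • t (s.equivFin.symm k) ≤ 0 := fun k _ =>
    mul_nonpos_of_nonneg_of_nonpos (hw0 _ (s.equivFin.symm k).2) (ht _).le
  -- The combination is both nonpositive and a value of `T x`, so every term vanishes; as each `t`
  -- is negative, all weights are 0.
  have hzero := (Finset.sum_eq_zero_iff_of_nonpos hle).1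
    (le_antisymm (Finset.sum_nonpos hle) hnonneg)
  refine zero_ne_one ((Finset.sum_eq_zero fun k hk => ?_).symm.trans h1)
  exact (mul_eq_zero.1 (hzero k hk)).resolve_right (ht _).ne

/-- Lower semicontinuity propagates a negative value to nearby points of the domain. -/
theorem SetValued.LscWithinAt.eventually_inter_Iio {Z : Type*} [TopologicalSpace Z]
    {T : Z → Set ℝ} {S : Set Z} {z : Z} (h : SetValued.LscWithinAt T S z)
    (hz : (T z ∩ Set.Iio 0).Nonempty) :
    ∀ᶠ w in nhdsWithin z (S ∩ SetValued.dom T), (T w ∩ Set.Iio 0).Nonempty :=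
  (lowerHemicontinuousWithinAt_iff.1 h.2) _ isOpen_Iio hz

theorem SetValued.subset_Ici_iff {A : Set ℝ} : A ⊆ Set.Ici 0 ↔ ¬ (A ∩ Set.Iio 0).Nonempty := by
  rw [Set.not_nonempty_iff_eq_empty, ← Set.disjoint_iff_inter_eq_empty,
    ← Set.compl_Ici, Set.disjoint_compl_right_iff_subset]

/-! ### The equilibrium theorem -/

theorem theorem4p1 {X : Type*} [AddCommGroup X] [Module ℝ X] [TopologicalSpace X]
    [IsTopologicalAddGroup X] [ContinuousSMul ℝ X] [LocallyConvexSpace ℝ X] [T2Space X]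
    (K D : Set X) (hKne : K.Nonempty) (hKconv : Convex ℝ K) (hKclosed : IsClosed K)
    (hD : SelfSegmentDense D K)
    -- only the values of `F` on `K × K` matter
    (F : X → X → Set ℝ)
    (h1 : ∀ y ∈ D, ∀ x ∈ K, SetValued.LscWithinAt (fun z => F z y) K x)
    (h2 : ∀ x ∈ K, ∀ y ∈ K \ D, SetValued.LscWithinAt (F x) K y)
    (h3 : ∀ x ∈ D, SetValued.ConvexOn (F x) D)
    (h4 : ∀ x ∈ D, F x x ⊆ Set.Ici 0)
    (h5 : ∃ K₀ : Set X, IsCompact K₀ ∧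
      ∃ y₀ ∈ D ∩ K₀, ∀ x ∈ K \ K₀, (F x y₀ ∩ Set.Iio 0).Nonempty) :
    ∃ x₀ ∈ K, ∀ y ∈ K, F x₀ y ⊆ Set.Ici 0 := by
  classical
  obtain ⟨K₀, hK₀, y₀, ⟨hy₀D, -⟩, hcoer⟩ := h5
  let G : X → Set X := fun y => {x ∈ K | F x y ⊆ Set.Ici 0}
  have hGclosed : ∀ y ∈ D, IsClosed (G y) := by
    intro y hy
    rw [← isOpen_compl_iff, isOpen_iff_mem_nhds]
    intro x hx
    by_cases hxK : x ∈ K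
    · have hneg : (F x y ∩ Set.Iio 0).Nonempty := by
        by_contra h
        exact hx ⟨hxK, SetValued.subset_Ici_iff.2 h⟩
      filter_upwards [eventually_nhdsWithin_iff.1 ((h1 y hy x hxK).eventually_inter_Iio hneg)]
        with w hw hwG
      exact SetValued.subset_Ici_iff.1 hwG.2 (hw ⟨hwG.1, (h1 y hy w hwG.1).1⟩)
    · filter_upwards [hKclosed.isOpen_compl.mem_nhds hxK] with w hw hwG
      exact hw hwG.1
  have hGy₀ : IsCompact (G y₀) := hK₀.of_isClosed_subset (hGclosed y₀ hy₀D) fun x hx => by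
    by_contra hxK₀
    exact SetValued.subset_Ici_iff.1 hx.2 (hcoer x ⟨hx.1, hxK₀⟩)
  have hface : ∀ s : Finset X, (s : Set X) ⊆ D → ∀ p ∈ convexHull ℝ (s : Set X),
      ∃ v ∈ s, p ∈ G v := by
    intro s hs p hp
    have hclosed : IsClosed (⋃ v ∈ s, G v) :=
      isClosed_biUnion_finset fun v hv => hGclosed v (hs hv)
    have hsub : convexHull ℝ (s : Set X) ∩ D ⊆ ⋃ v ∈ s, G v := by
      rintro x ⟨hx, hxD⟩
      obtain ⟨v, hv, hFv⟩ := (h3 x hxD).exists_subset_Ici hs hxD hx (h4 x hxD)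
      exact Set.mem_biUnion hv ⟨hD.subset hxD, hFv⟩
    simpa using closure_minimal hsub hclosed (hD.convexHull_subset_closure s hs hp)
  obtain ⟨x₀, hx₀, hx₀G⟩ := hGy₀.inter_iInter_nonempty (fun y : D => G y)
    (fun y => hGclosed y y.2) fun u => by
      -- Adjoining `y₀` keeps the common point in the compact set `G y₀`. The closed sets are pulled
      -- back along `φ`, so KKM is needed only on a standard simplex.
      let J := {y : D // y ∈ insert (⟨y₀, hy₀D⟩ : D) u}
      have : Nonempty J := ⟨⟨_, Finset.mem_insert_self _ u⟩⟩
      let φ : (J → ℝ) → X := fun x => ∑ j, x j • (j.1 : X)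
      have hφ : Continuous φ := continuous_finsetSum _ fun j _ => by fun_prop
      obtain ⟨x, -, hx⟩ := exists_mem_iInter_of_forall_exists_pos
        (B := fun j : J => φ ⁻¹' G j.1) (fun j => (hGclosed _ j.1.2).preimage hφ) fun x hx => by
          have hmem : φ x ∈ convexHull ℝ
              (((Finset.univ.filter fun j => 0 < x j).image fun j : J => (j.1 : X) :
                Finset X) : Set X) := by
            have hzero : ∀ j ∉ Finset.univ.filter fun j => 0 < x j, x j = 0 := fun j hj =>
              le_antisymm (not_lt.1 (by simpa using hj)) (hx.1 j)
            have hsum : φ x = ∑ j ∈ Finset.univ.filter fun j => 0 < x j, x j • (j.1 : X) :=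
              (Finset.sum_subset (Finset.subset_univ _) fun j _ hj => by
                rw [hzero j hj, zero_smul]).symm
            rw [hsum]
            refine (convex_convexHull ℝ _).sum_mem (fun j _ => hx.1 j) ?_ fun j hj =>
              subset_convexHull ℝ _ (Finset.mem_coe.2 (Finset.mem_image_of_mem _ hj))
            rw [← hx.2]
            exact Finset.sum_subset (Finset.subset_univ _) fun j _ hj => hzero j hj
          obtain ⟨v, hv, hvG⟩ := hface _ (by
            intro v hv
            obtain ⟨j, -, rfl⟩ := Finset.mem_image.1 (Finset.mem_coe.1 hv)
            exact j.1.2) _ hmem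
          obtain ⟨j, hj, rfl⟩ := Finset.mem_image.1 hv
          exact ⟨j, (Finset.mem_filter.1 hj).2, hvG⟩
      exact ⟨φ x, hx ⟨_, Finset.mem_insert_self _ u⟩, Set.mem_iInter₂.2 fun y hy =>
        hx ⟨y, Finset.mem_insert_of_mem hy⟩⟩
  have hx₀D : ∀ y ∈ D, F x₀ y ⊆ Set.Ici 0 := fun y hy => (Set.mem_iInter.1 hx₀G ⟨y, hy⟩).2
  refine ⟨x₀, hx₀.1, fun y hy => ?_⟩
  by_cases hyD : y ∈ D
  · exact hx₀D y hyD
  rw [SetValued.subset_Ici_iff]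
  intro hneg
  -- A negative value at `y` would persist at nearby points of `D`, where it is excluded.
  have hev := eventually_nhdsWithin_iff.1 ((h2 x₀ hx₀.1 y ⟨hy, hyD⟩).eventually_inter_Iio hneg)
  obtain ⟨w, hw, hwD⟩ := mem_closure_iff_nhds.1 (hD.dense hy) _ hev
  exact SetValued.subset_Ici_iff.1 (hx₀D w hwD) (hw ⟨hD.subset hwD, (h1 w hwD x₀ hx₀.1).1⟩)
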